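/- An interbank lending game $G$ has lenders $L=\{1,\dots,m\}$ with budgets $c_i>0$, borrowers $B=\{1,\dots,n\}$ with demands $d_j>0$, and rates $0<r_{\min}<r_{\max}$. Lender $i$ chooses a strategy in $S_i=\{x\in\mathbb R_{\ge 0}^n:\sum_{j\in B}x_j\le c_i\}$; write $\boldsymbol S=\prod_{i\in L}S_i$. At a profile $\boldsymbol s=(s_{ij})\in\boldsymbol S$ borrower $j$ offers the rate $r_j(\boldsymbol s)=(r_{\min}-r_{\max})\frac{\sum_{i\in L}s_{ij}}{d_j}+r_{\max}$, and lender $i$ has utility $u_i(\boldsymbol s)=\sum_{j\in B}(r_j(\boldsymbol s)-r_{\min})s_{ij}$. A pure Nash equilibrium is a profile $\boldsymbol s\in\boldsymbol S$ with $u_i(\boldsymbol s)\ge u_i(z,\boldsymbol s_{-i})$ for all $i\in L$ and $z\in S_i$, and $\mathrm{BR}_i(\boldsymbol s)=\arg\max_{z\in S_i}u_i(z,\boldsymbol s_{-i})$. For $\alpha\in(0,1]$ and $\boldsymbol s^0\in\boldsymbol S$, a randomised $\alpha$-uniform best-response dynamics started at $\boldsymbol s^0$ is a random sequence of profiles $(\boldsymbol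 s^t)_{t\ge 0}$ with random lenders $i^t\in L$ such that at every time $t$, given the history (a filtration $(\mathcal F_t)_{t\ge0}$ such that $\boldsymbol s^t$ is $\mathcal F_t$-measurable and $i^t$ is $\mathcal F_{t+1}$-measurable), the updating lender $i^t$ is drawn from a probability distribution $\pi^t$ on $L$ (fixed, or depending on the history), where for some constant $p_{\min}>0$ almost surely $\pi^t(k)\ge p_{\min}$ for all $t$ and all $k\in L$; and, almost surely, for every $t$, the next profile $\boldsymbol s^{t+1}$ agrees with $\boldsymbol s^t$ except that $s^{t+1}_{i^t}=s^t_{i^t}+\alpha(\hat s-s^t_{i^t})$ for some $\hat s\in\mathrm{BR}_{i^t}(\boldsymbol s^t)$. **Theorem.** Every lending game $G$ has a unique pure Nash equilibrium $\boldsymbol s^\ast$, and for any $\alpha\in(0,1]$ and any initial profile $\boldsymbol s^0\in\boldsymbol S$, every randomised $\alpha$-uniform best-response dynamics started at $\boldsymbol s^0$ satisfies $\boldsymbol s^t\to\boldsymbol s^\ast$ almost surely. -/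

import Mathlib

open MeasureTheory Filter Topology

/-- An interbank lending game with lenders `Fin m` and borrowers `Fin n`: budgets `c`, demands `d`,
and interest rates `0 < rmin < rmax`. -/
structure LendingGame (m n : ℕ) where
  c : Fin m → ℝ
  d : Fin n → ℝ
  rmin : ℝ
  rmax : ℝ
  c_pos : ∀ i, 0 < c i
  d_pos : ∀ j, 0 < d j
  rmin_pos : 0 < rmin
  rmin_lt_rmax : rmin < rmax

namespace LendingGame

variable {m n : ℕ}

/-- The strategy set `S_i` of lender `i`. -/
def strategySet (G : LendingGame m n) (i : Fin m) : Set (Fin n → ℝ) :=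
  {x | (∀ j, 0 ≤ x j) ∧ ∑ j, x j ≤ G.c i}

/-- The strategy space `S`, the product of the strategy sets; `s i j` is the amount that lender `i`
lends to borrower `j`. -/
def strategySpace (G : LendingGame m n) : Set (Fin m → Fin n → ℝ) :=
  {s | ∀ i, s i ∈ G.strategySet i}

/-- The interest rate `r_j(s)` offered by borrower `j`. -/
noncomputable def interestRate (G : LendingGame m n) (j : Fin n) (s : Fin m → Fin n → ℝ) : ℝ :=
  (G.rmin - G.rmax) * ((∑ i, s i j) / G.d j) + G.rmax

/-- The utility `u_i(s)` of lender `i`. -/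
noncomputable def utility (G : LendingGame m n) (i : Fin m) (s : Fin m → Fin n → ℝ) : ℝ :=
  ∑ j, (G.interestRate j s - G.rmin) * s i j

/-- Pure Nash equilibria; `Function.update s i z` is the profile `(z, s_{-i})`. -/
def IsPureNash (G : LendingGame m n) (s : Fin m → Fin n → ℝ) : Prop :=
  s ∈ G.strategySpace ∧
    ∀ i, ∀ z ∈ G.strategySet i, G.utility i (Function.update s i z) ≤ G.utility i s

/-- The best-response set `BR_i(s)`: the maximisers of `z ↦ u_i(z, s_{-i})` over `S_i`. -/
def bestResponses (G : LendingGame m n) (i : Fin m) (s : Fin m → Fin n → ℝ) :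
    Set (Fin n → ℝ) :=
  {z | z ∈ G.strategySet i ∧ ∀ y ∈ G.strategySet i,
    G.utility i (Function.update s i y) ≤ G.utility i (Function.update s i z)}

/-- `s` is a trajectory of the asynchronous `α`-uniform best-response dynamics started at `s₀`, in
which `i t` is the updating lender at time `t`. Time starts at `0`. -/
def IsBestResponseTrajectory (G : LendingGame m n) (α : ℝ) (s₀ : Fin m → Fin n → ℝ)
    (i : ℕ → Fin m) (s : ℕ → Fin m → Fin n → ℝ) : Prop :=
  s 0 = s₀ ∧ ∀ t, ∃ z ∈ G.bestResponses (i t) (s t),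
    s (t + 1) = Function.update (s t) (i t) (s t (i t) + α • (z - s t (i t)))

/-- The randomised `α`-uniform best-response dynamics started at `s₀`, on a probability space
`(Ω, μ)`. The σ-algebra `ℱ t` is the information available before the draw at time `t` (it contains
the current profile and all earlier profiles and draws). Given `ℱ t`, the updating lender
`i t` is drawn from the distribution `π t`; the distributions may be deterministic (independent
draws) or depend on the history. One constant `pMin > 0` bounds all selection probabilities from
below. -/
structure IsRandomisedBestResponseDynamics (G : LendingGame m n) (α : ℝ)
    (s₀ : Fin m → Fin n → ℝ) {Ω : Type*} [MeasurableSpace Ω] (μ : Measure Ω)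
    (ℱ : Filtration ℕ ‹MeasurableSpace Ω›) (π : ℕ → Ω → PMF (Fin m))
    (i : ℕ → Ω → Fin m) (s : ℕ → Ω → Fin m → Fin n → ℝ) : Prop where
  measurable_profile : ∀ t, Measurable[ℱ t] (s t)
  measurable_lender : ∀ t, Measurable[ℱ (t + 1)] (i t)
  trajectory : ∀ᵐ ω ∂μ, G.IsBestResponseTrajectory α s₀ (fun t => i t ω) (fun t => s t ω)
  lender_law : ∀ t k, μ[(i t ⁻¹' {k}).indicator (fun _ => (1 : ℝ)) | ℱ t]
    =ᵐ[μ] fun ω => (π t ω k).toReal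
  exists_pMin : ∃ pMin : ℝ, 0 < pMin ∧ ∀ t k, ∀ᵐ ω ∂μ, pMin ≤ (π t ω k).toReal

end LendingGame

/-! The game has an exact concave quadratic potential, so its maximiser on the compact
`strategySpace` is an equilibrium (`exists_isPureNash`). The marginal utilities are strictly
monotone, which gives uniqueness (`IsPureNash.eq`).

For convergence, let `gap k` be the best improvement open to lender `k`. By concavity, each update
raises the potential by at least `α` times the updating lender's gap, so along a trajectory these
gaps have a bounded sum. Each lender is drawn with conditional probability at least `pMin`, so for
every fixed `k` the expected sum of `gap k` over all times, drawn or not, is finite, and `gap k`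
tends to zero almost surely. The gaps are continuous and vanish together only at the equilibrium;
compactness finishes the proof. -/

/-! ### From sums over random draws to sums over all times. -/

/-- If the nonnegative bounded variables `X t`, accumulated along events `A t` that have conditional
probability at least `p > 0`, have bounded total sum, then `X t → 0` almost surely. -/
theorem ae_tendsto_zero_of_sum_indicator_le {Ω : Type*} [m0 : MeasurableSpace Ω] {μ : Measure Ω}
    [IsProbabilityMeasure μ] {ℱ : Filtration ℕ m0} {X : ℕ → Ω → ℝ} {A : ℕ → Set Ω} {p C D : ℝ}
    (hp : 0 < p) (hX : ∀ t, StronglyMeasurable[ℱ t] (X t)) (hA : ∀ t, MeasurableSet (A t))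
    (hX0 : ∀ t, ∀ᵐ ω ∂μ, 0 ≤ X t ω) (hXC : ∀ t, ∀ᵐ ω ∂μ, X t ω ≤ C)
    (hcond : ∀ t, ∀ᵐ ω ∂μ, p ≤ (μ[(A t).indicator (fun _ => (1 : ℝ)) | ℱ t]) ω)
    (hsum : ∀ T, ∀ᵐ ω ∂μ, ∑ t ∈ Finset.range T, (A t).indicator (fun _ => (1 : ℝ)) ω * X t ω ≤ D) :
    ∀ᵐ ω ∂μ, Tendsto (fun t => X t ω) atTop (𝓝 0) := by
  have hXi : ∀ t, Integrable (X t) μ := fun t =>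
    Integrable.of_bound ((hX t).mono (ℱ.le t)).aestronglyMeasurable C (by
      filter_upwards [hX0 t, hXC t] with ω h0 hC
      rwa [Real.norm_of_nonneg h0])
  have hAi : ∀ t, Integrable ((A t).indicator (fun _ => (1 : ℝ))) μ := fun t =>
    (integrable_const 1).indicator (hA t)
  have hAXi : ∀ t, Integrable ((A t).indicator (fun _ => (1 : ℝ)) * X t) μ := fun t => by
    have : (A t).indicator (fun _ => (1 : ℝ)) * X t = (A t).indicator (X t) := by
      ext ω
      by_cases h : ω ∈ A t <;> simp [h]
    rw [this]
    exact (hXi t).indicator (hA t)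
  -- `X t` is known before the draw, so it factors out of the conditional expectation given `ℱ t`.
  have hstep : ∀ t, p * ∫ ω, X t ω ∂μ
      ≤ ∫ ω, (A t).indicator (fun _ => (1 : ℝ)) ω * X t ω ∂μ := fun t => by
    have hpull := condExp_mul_of_stronglyMeasurable_right (hX t) (hAXi t) (hAi t)
    have h1 : ∫ ω, (A t).indicator (fun _ => (1 : ℝ)) ω * X t ω ∂μ
        = ∫ ω, (μ[(A t).indicator (fun _ => (1 : ℝ)) | ℱ t] * X t) ω ∂μ := by
      rw [← integral_congr_ae hpull, integral_condExp (ℱ.le t)]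
      rfl
    rw [h1, ← integral_const_mul]
    refine integral_mono_ae ((hXi t).const_mul p) (integrable_condExp.congr hpull) ?_
    filter_upwards [hX0 t, hcond t] with ω h0 hc
    exact mul_le_mul_of_nonneg_right hc h0
  have hbound : ∀ T, ∑ t ∈ Finset.range T, ∫ ω, X t ω ∂μ ≤ D / p := fun T => by
    rw [le_div_iff₀' hp, Finset.mul_sum]
    refine (Finset.sum_le_sum fun t _ => hstep t).trans ?_
    have hAXi' : ∀ t, Integrable (fun ω => (A t).indicator (fun _ => (1 : ℝ)) ω * X t ω) μ := hAXi
    rw [← integral_finsetSum _ fun t _ => hAXi' t]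
    refine (integral_mono_ae (integrable_finsetSum _ fun t _ => hAXi' t)
      (integrable_const D) (hsum T)).trans ?_
    simp
  have hsummable : Summable fun t => ∫ ω, X t ω ∂μ :=
    summable_of_sum_range_le (fun t => integral_nonneg_of_ae (hX0 t)) hbound
  have hlint : ∫⁻ ω, ∑' t, ENNReal.ofReal (X t ω) ∂μ ≠ ⊤ := by
    rw [lintegral_tsum fun t => (hXi t).aemeasurable.ennreal_ofReal]
    simp_rw [← fun t => ofReal_integral_eq_lintegral_ofReal (hXi t) (hX0 t)]
    exact hsummable.tsum_ofReal_ne_top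
  have hfin := ae_lt_top' (AEMeasurable.tsum fun t =>
    (hXi t).aemeasurable.ennreal_ofReal) hlint
  filter_upwards [hfin, ae_all_iff.2 hX0] with ω hω h0
  have h := ENNReal.tendsto_atTop_zero_of_tsum_ne_top hω.ne
  have := (ENNReal.tendsto_toReal ENNReal.zero_ne_top).comp h
  simpa [Function.comp_def, ENNReal.toReal_ofReal (h0 _)] using this

namespace LendingGame

variable {m n : ℕ} (G : LendingGame m n)

/-! ### Compactness and convexity of the strategy sets. -/

theorem isCompact_strategySet (i : Fin m) : IsCompact (G.strategySet i) := by
  refine (isCompact_univ_pi fun _ : Fin n =>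
    isCompact_Icc (a := (0 : ℝ)) (b := G.c i)).of_isClosed_subset ?_ ?_
  · simp only [strategySet, Set.ofPred_and, Set.ofPred_forall]
    exact (isClosed_iInter fun j => isClosed_le continuous_const (continuous_apply j)).inter
      (isClosed_le (by fun_prop) continuous_const)
  · intro x hx j _
    exact ⟨hx.1 j, (Finset.single_le_sum (fun k _ => hx.1 k) (Finset.mem_univ j)).trans hx.2⟩

theorem strategySpace_eq_pi : G.strategySpace = Set.univ.pi G.strategySet := by
  ext s
  simp [strategySpace]

theorem isCompact_strategySpace : IsCompact G.strategySpace :=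
  G.strategySpace_eq_pi ▸ isCompact_univ_pi G.isCompact_strategySet

theorem zero_mem_strategySet (i : Fin m) : (0 : Fin n → ℝ) ∈ G.strategySet i :=
  ⟨fun _ => le_rfl, by simpa using (G.c_pos i).le⟩

theorem add_smul_sub_mem_strategySet {i : Fin m} {x z : Fin n → ℝ} {a : ℝ}
    (hx : x ∈ G.strategySet i) (hz : z ∈ G.strategySet i) (h0 : 0 ≤ a) (h1 : a ≤ 1) :
    x + a • (z - x) ∈ G.strategySet i := by
  constructor
  · intro j
    have := mul_nonneg h0 (hz.1 j)
    have := mul_nonneg (sub_nonneg.2 h1) (hx.1 j)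
    simp only [Pi.add_apply, Pi.smul_apply, Pi.sub_apply, smul_eq_mul]
    linarith
  · have := mul_le_mul_of_nonneg_left hz.2 h0
    have := mul_le_mul_of_nonneg_left hx.2 (sub_nonneg.2 h1)
    simp only [Pi.add_apply, Pi.smul_apply, Pi.sub_apply, smul_eq_mul, Finset.sum_add_distrib,
      ← Finset.mul_sum, Finset.sum_sub_distrib]
    linarith

/-! ### The exact potential. -/

/-- The change of lender `i`'s utility when its strategy `s i` moves to `s i + v`. -/
noncomputable def gain (i : Fin m) (s : Fin m → Fin n → ℝ) (v : Fin n → ℝ) : ℝ :=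
  ∑ j, (G.rmax - G.rmin) * (v j - ((∑ k, s k j) * v j + s i j * v j + v j ^ 2) / G.d j)

/-- An exact potential of the game. -/
noncomputable def potential (s : Fin m → Fin n → ℝ) : ℝ :=
  ∑ j, (G.rmax - G.rmin) *
    ((∑ k, s k j) - ((∑ k, s k j) ^ 2 + ∑ k, s k j ^ 2) / (2 * G.d j))

theorem sum_update_add (s : Fin m → Fin n → ℝ) (i : Fin m) (v : Fin n → ℝ) (j : Fin n) :
    ∑ k, Function.update s i (s i + v) k j = (∑ k, s k j) + v j := by
  rw [← Finset.add_sum_erase _ _ (Finset.mem_univ i),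
    ← Finset.add_sum_erase _ (fun k => s k j) (Finset.mem_univ i),
    Finset.sum_congr rfl fun k hk => by rw [Function.update_of_ne (Finset.ne_of_mem_erase hk)]]
  simp only [Function.update_self, Pi.add_apply]
  ring

theorem sum_update_add_sq (s : Fin m → Fin n → ℝ) (i : Fin m) (v : Fin n → ℝ) (j : Fin n) :
    ∑ k, Function.update s i (s i + v) k j ^ 2
      = (∑ k, s k j ^ 2) + 2 * s i j * v j + v j ^ 2 := by
  rw [← Finset.add_sum_erase _ _ (Finset.mem_univ i),
    ← Finset.add_sum_erase _ (fun k => s k j ^ 2) (Finset.mem_univ i),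
    Finset.sum_congr rfl fun k hk => by rw [Function.update_of_ne (Finset.ne_of_mem_erase hk)]]
  simp only [Function.update_self, Pi.add_apply]
  ring

theorem utility_update_add (s : Fin m → Fin n → ℝ) (i : Fin m) (v : Fin n → ℝ) :
    G.utility i (Function.update s i (s i + v)) = G.utility i s + G.gain i s v := by
  simp only [utility, gain, interestRate, sum_update_add, Function.update_self, Pi.add_apply,
    ← Finset.sum_add_distrib]
  refine Finset.sum_congr rfl fun j _ => ?_
  ring

theorem potential_update_add (s : Fin m → Fin n → ℝ) (i : Fin m) (v : Fin n → ℝ) :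
    G.potential (Function.update s i (s i + v)) = G.potential s + G.gain i s v := by
  simp only [potential, gain, sum_update_add, sum_update_add_sq, ← Finset.sum_add_distrib]
  refine Finset.sum_congr rfl fun j _ => ?_
  have := (G.d_pos j).ne'
  field_simp
  ring

theorem utility_update (s : Fin m → Fin n → ℝ) (i : Fin m) (z : Fin n → ℝ) :
    G.utility i (Function.update s i z) = G.utility i s + G.gain i s (z - s i) := by
  rw [← utility_update_add, add_sub_cancel]

/-- The gain is a linear form `L` in `v` minus a quadratic form `Q`, and `a * L - a ^ 2 * Q = a * (L
- Q) + a * (1 - a) * Q`. -/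
theorem gain_smul (i : Fin m) (s : Fin m → Fin n → ℝ) (v : Fin n → ℝ) (a : ℝ) :
    G.gain i s (a • v) = a * G.gain i s v
      + a * (1 - a) * ∑ j, (G.rmax - G.rmin) * (v j ^ 2 / G.d j) := by
  simp only [gain, Finset.mul_sum, ← Finset.sum_add_distrib, Pi.smul_apply, smul_eq_mul]
  refine Finset.sum_congr rfl fun j _ => ?_
  ring

theorem sum_sq_div_nonneg (v : Fin n → ℝ) :
    0 ≤ ∑ j, (G.rmax - G.rmin) * (v j ^ 2 / G.d j) :=
  Finset.sum_nonneg fun j _ => mul_nonneg (sub_pos.2 G.rmin_lt_rmax).le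
    (div_nonneg (sq_nonneg _) (G.d_pos j).le)

theorem mul_gain_le_gain_smul (i : Fin m) (s : Fin m → Fin n → ℝ) (v : Fin n → ℝ) {a : ℝ}
    (h0 : 0 ≤ a) (h1 : a ≤ 1) : a * G.gain i s v ≤ G.gain i s (a • v) := by
  rw [gain_smul]
  exact le_add_of_nonneg_right
    (mul_nonneg (mul_nonneg h0 (sub_nonneg.2 h1)) (G.sum_sq_div_nonneg v))

theorem continuous_potential : Continuous G.potential := by
  unfold potential
  fun_prop

/-! ### Existence and uniqueness of the equilibrium. -/

theorem isPureNash_iff_gain_nonpos {s : Fin m → Fin n → ℝ} :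
    G.IsPureNash s ↔
      s ∈ G.strategySpace ∧ ∀ i, ∀ z ∈ G.strategySet i, G.gain i s (z - s i) ≤ 0 := by
  simp only [IsPureNash, utility_update, add_le_iff_nonpos_right]

theorem exists_isPureNash : ∃ s, G.IsPureNash s := by
  obtain ⟨s, hs, hmax⟩ := G.isCompact_strategySpace.exists_isMaxOn
    ⟨fun _ => 0, G.zero_mem_strategySet⟩ G.continuous_potential.continuousOn
  refine ⟨s, G.isPureNash_iff_gain_nonpos.2 ⟨hs, fun i z hz => ?_⟩⟩
  have hmem : Function.update s i (s i + (z - s i)) ∈ G.strategySpace := by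
    rw [add_sub_cancel]
    intro k
    obtain rfl | hk := eq_or_ne k i
    · simpa using hz
    · simpa [hk] using hs k
  have h := hmax hmem
  simp only [Set.mem_ofPred_eq, potential_update_add] at h
  linarith

/-- The first-order optimality condition at a pure Nash equilibrium. -/
theorem IsPureNash.gain_add_sum_sq_nonpos {G : LendingGame m n} {s : Fin m → Fin n → ℝ}
    (hs : G.IsPureNash s) {i : Fin m} {z : Fin n → ℝ} (hz : z ∈ G.strategySet i) :
    G.gain i s (z - s i) + ∑ j, (G.rmax - G.rmin) * ((z - s i) j ^ 2 / G.d j) ≤ 0 := by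
  set Q := ∑ j, (G.rmax - G.rmin) * ((z - s i) j ^ 2 / G.d j) with hQ
  rw [isPureNash_iff_gain_nonpos] at hs
  -- The gain of the feasible step `a • (z - s i)`, divided by `a`, as `a` decreases to 0.
  have hlim : Tendsto (fun a : ℝ => G.gain i s (z - s i) + (1 - a) * Q) (𝓝[>] 0)
      (𝓝 (G.gain i s (z - s i) + (1 - 0) * Q)) :=
    (Continuous.tendsto (by fun_prop) 0).mono_left nhdsWithin_le_nhds
  rw [sub_zero, one_mul] at hlim
  refine le_of_tendsto hlim ?_
  filter_upwards [Ioc_mem_nhdsGT (zero_lt_one' ℝ)] with a ha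
  have h := hs.2 i _ (G.add_smul_sub_mem_strategySet (hs.1 i) hz ha.1.le ha.2)
  rw [add_sub_cancel_left, gain_smul, ← hQ, mul_assoc, ← mul_add] at h
  exact nonpos_of_mul_nonpos_right h ha.1

theorem IsPureNash.eq {G : LendingGame m n} {s s' : Fin m → Fin n → ℝ}
    (hs : G.IsPureNash s) (hs' : G.IsPureNash s') : s' = s := by
  have hR := sub_pos.2 G.rmin_lt_rmax
  -- Each equilibrium is tested against the other. In the sum the constant marginal terms cancel,
  -- leaving a positive definite quadratic form in `s' - s`.
  have h1 := Finset.sum_nonpos fun i (_ : i ∈ Finset.univ) =>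
    add_nonpos (hs.gain_add_sum_sq_nonpos (hs'.1 i)) (hs'.gain_add_sum_sq_nonpos (hs.1 i))
  have h2 : ∑ i, (G.gain i s (s' i - s i) + ∑ j, (G.rmax - G.rmin) * ((s' i - s i) j ^ 2 / G.d j)
      + (G.gain i s' (s i - s' i) + ∑ j, (G.rmax - G.rmin) * ((s i - s' i) j ^ 2 / G.d j)))
      = ∑ j, (G.rmax - G.rmin) / G.d j *
        ((∑ i, (s' i j - s i j)) ^ 2 + ∑ i, (s' i j - s i j) ^ 2) := by
    have h3 : ∀ j, (G.rmax - G.rmin) / G.d j *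
        ((∑ i, (s' i j - s i j)) ^ 2 + ∑ i, (s' i j - s i j) ^ 2)
        = ∑ i, (G.rmax - G.rmin) / G.d j *
          (((∑ k, s' k j) - ∑ k, s k j) * (s' i j - s i j) + (s' i j - s i j) ^ 2) := fun j => by
      rw [← Finset.mul_sum, Finset.sum_add_distrib, ← Finset.mul_sum, Finset.sum_sub_distrib, sq]
    simp_rw [h3]
    rw [Finset.sum_comm]
    refine Finset.sum_congr rfl fun i _ => ?_
    simp only [gain, ← Finset.sum_add_distrib, Pi.sub_apply]
    refine Finset.sum_congr rfl fun j _ => ?_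
    ring
  rw [h2] at h1
  have hterm : ∀ j, 0 ≤ (G.rmax - G.rmin) / G.d j *
      ((∑ i, (s' i j - s i j)) ^ 2 + ∑ i, (s' i j - s i j) ^ 2) := fun j =>
    mul_nonneg (div_pos hR (G.d_pos j)).le
      (add_nonneg (sq_nonneg _) (Finset.sum_nonneg fun i _ => sq_nonneg _))
  ext i j
  have h4 := (Finset.sum_eq_zero_iff_of_nonneg fun j _ => hterm j).1
    (le_antisymm h1 (Finset.sum_nonneg fun j _ => hterm j)) j (Finset.mem_univ j)
  have h5 := (mul_eq_zero.1 h4).resolve_left (div_pos hR (G.d_pos j)).ne'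
  have h6 := Finset.single_le_sum (f := fun i => (s' i j - s i j) ^ 2)
    (fun i _ => sq_nonneg _) (Finset.mem_univ i)
  have h7 : (s' i j - s i j) ^ 2 = 0 := by
    have := sq_nonneg (∑ i, (s' i j - s i j))
    have := sq_nonneg (s' i j - s i j)
    linarith
  exact sub_eq_zero.1 (pow_eq_zero_iff two_ne_zero |>.1 h7)

/-! ### Best-response gaps. -/

/-- The largest utility gain available to lender `i` at the profile `s`. -/
noncomputable def gap (i : Fin m) (s : Fin m → Fin n → ℝ) : ℝ :=
  sSup ((fun z => G.gain i s (z - s i)) '' G.strategySet i)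

theorem continuous_gain_sub (i : Fin m) :
    Continuous fun p : (Fin m → Fin n → ℝ) × (Fin n → ℝ) => G.gain i p.1 (p.2 - p.1 i) := by
  unfold gain
  simp only [Pi.sub_apply]
  fun_prop

theorem continuous_gap (i : Fin m) : Continuous (G.gap i) :=
  (G.isCompact_strategySet i).continuous_sSup (G.continuous_gain_sub i)

theorem gain_le_gap {i : Fin m} (s : Fin m → Fin n → ℝ) {z : Fin n → ℝ}
    (hz : z ∈ G.strategySet i) : G.gain i s (z - s i) ≤ G.gap i s := by
  refine le_csSup ?_ (Set.mem_image_of_mem _ hz)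
  refine ((G.isCompact_strategySet i).image ?_).bddAbove
  exact (G.continuous_gain_sub i).comp (by fun_prop : Continuous fun z : Fin n → ℝ => (s, z))

theorem gap_nonneg {i : Fin m} {s : Fin m → Fin n → ℝ} (hs : s i ∈ G.strategySet i) :
    0 ≤ G.gap i s := by
  have h : G.gain i s (s i - s i) = 0 := by simp [gain]
  exact h ▸ G.gain_le_gap s hs

theorem gap_le_gain_of_mem_bestResponses {i : Fin m} {s : Fin m → Fin n → ℝ} {z : Fin n → ℝ}
    (hz : z ∈ G.bestResponses i s) : G.gap i s ≤ G.gain i s (z - s i) := by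
  refine csSup_le (Set.Nonempty.image _ ⟨z, hz.1⟩) ?_
  rintro _ ⟨y, hy, rfl⟩
  simpa only [utility_update, add_le_add_iff_left] using hz.2 y hy

theorem isPureNash_of_gap_eq_zero {s : Fin m → Fin n → ℝ} (hs : s ∈ G.strategySpace)
    (h : ∀ i, G.gap i s = 0) : G.IsPureNash s :=
  G.isPureNash_iff_gain_nonpos.2 ⟨hs, fun i _ hz => (G.gain_le_gap s hz).trans (h i).le⟩

/-! ### Potential growth along trajectories, and convergence. -/

section Trajectory

variable {G} {α : ℝ} {s₀ : Fin m → Fin n → ℝ} {i : ℕ → Fin m} {s : ℕ → Fin m → Fin n → ℝ}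

theorem IsBestResponseTrajectory.mem_strategySpace (h : G.IsBestResponseTrajectory α s₀ i s)
    (h0 : 0 ≤ α) (h1 : α ≤ 1) (hs₀ : s₀ ∈ G.strategySpace) (t : ℕ) : s t ∈ G.strategySpace := by
  induction t with
  | zero => rwa [h.1]
  | succ t ih =>
    obtain ⟨z, hz, hstep⟩ := h.2 t
    rw [hstep]
    intro k
    obtain rfl | hk := eq_or_ne k (i t)
    · simpa using G.add_smul_sub_mem_strategySet (ih _) hz.1 h0 h1
    · simpa [hk] using ih k

/-- The gain is concave in the step and vanishes at zero, so a fraction `α` of a best-response step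
earns at least `α` times its gain. -/
theorem IsBestResponseTrajectory.mul_gap_le (h : G.IsBestResponseTrajectory α s₀ i s)
    (h0 : 0 ≤ α) (h1 : α ≤ 1) (t : ℕ) :
    α * G.gap (i t) (s t) ≤ G.potential (s (t + 1)) - G.potential (s t) := by
  obtain ⟨z, hz, hstep⟩ := h.2 t
  rw [hstep, potential_update_add, add_sub_cancel_left]
  exact (mul_le_mul_of_nonneg_left (G.gap_le_gain_of_mem_bestResponses hz) h0).trans
    (G.mul_gain_le_gain_smul _ _ _ h0 h1)

theorem IsBestResponseTrajectory.sum_gap_le (h : G.IsBestResponseTrajectory α s₀ i s)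
    (h0 : 0 < α) (h1 : α ≤ 1) (T : ℕ) :
    ∑ t ∈ Finset.range T, G.gap (i t) (s t) ≤ (G.potential (s T) - G.potential s₀) / α := by
  rw [le_div_iff₀' h0, Finset.mul_sum, ← h.1, ← Finset.sum_range_sub (fun t => G.potential (s t))]
  exact Finset.sum_le_sum fun t _ => h.mul_gap_le h0.le h1 t

end Trajectory

/-- By continuity all gaps vanish at any cluster point, which is therefore the unique equilibrium.
-/
theorem tendsto_of_gap_tendsto_zero {sStar : Fin m → Fin n → ℝ} (hStar : G.IsPureNash sStar)
    {s : ℕ → Fin m → Fin n → ℝ} (hs : ∀ t, s t ∈ G.strategySpace)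
    (hgap : ∀ k, Tendsto (fun t => G.gap k (s t)) atTop (𝓝 0)) :
    Tendsto s atTop (𝓝 sStar) := by
  refine G.isCompact_strategySpace.tendsto_nhds_of_unique_mapClusterPt (Eventually.of_forall hs)
    fun x hx hcl => hStar.eq (G.isPureNash_of_gap_eq_zero hx fun k => ?_)
  have h : MapClusterPt (G.gap k x) atTop (G.gap k ∘ s) :=
    hcl.continuousAt_comp (G.continuous_gap k).continuousAt
  have h' : ClusterPt (G.gap k x) (𝓝 (0 : ℝ)) := ClusterPt.mono h (hgap k)
  have : NeBot (𝓝 (G.gap k x) ⊓ 𝓝 (0 : ℝ)) := h'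
  exact eq_of_nhds_neBot this

theorem IsRandomisedBestResponseDynamics.ae_tendsto {G : LendingGame m n} {α : ℝ}
    {s₀ sStar : Fin m → Fin n → ℝ} (hStar : G.IsPureNash sStar) (h0 : 0 < α) (h1 : α ≤ 1)
    (hs₀ : s₀ ∈ G.strategySpace) {Ω : Type*} [MeasurableSpace Ω] {μ : Measure Ω}
    [IsProbabilityMeasure μ] {ℱ : Filtration ℕ ‹MeasurableSpace Ω›} {π : ℕ → Ω → PMF (Fin m)}
    {i : ℕ → Ω → Fin m} {s : ℕ → Ω → Fin m → Fin n → ℝ}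
    (h : G.IsRandomisedBestResponseDynamics α s₀ μ ℱ π i s) :
    ∀ᵐ ω ∂μ, Tendsto (fun t => s t ω) atTop (𝓝 sStar) := by
  have hmem : ∀ᵐ ω ∂μ, ∀ t, s t ω ∈ G.strategySpace := by
    filter_upwards [h.trajectory] with ω hω t
    exact hω.mem_strategySpace h0.le h1 hs₀ t
  obtain ⟨p, hp, hπ⟩ := h.exists_pMin
  obtain ⟨M, hM⟩ := (G.isCompact_strategySpace.image G.continuous_potential).bddAbove
  have hgap : ∀ k, ∀ᵐ ω ∂μ, Tendsto (fun t => G.gap k (s t ω)) atTop (𝓝 0) := fun k => by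
    obtain ⟨C, hC⟩ := (G.isCompact_strategySpace.image (G.continuous_gap k)).bddAbove
    refine ae_tendsto_zero_of_sum_indicator_le (ℱ := ℱ) (A := fun t => i t ⁻¹' {k}) (C := C)
      (D := (M - G.potential s₀) / α) hp
      (fun t => ((G.continuous_gap k).measurable.comp (h.measurable_profile t)).stronglyMeasurable)
      (fun t => ℱ.le (t + 1) _ (h.measurable_lender t (measurableSet_singleton k)))
      (fun t => ?_) (fun t => ?_) (fun t => ?_) (fun T => ?_)
    · filter_upwards [hmem] with ω hω
      exact G.gap_nonneg (hω t k)
    · filter_upwards [hmem] with ω hω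
      exact hC (Set.mem_image_of_mem _ (hω t))
    · filter_upwards [h.lender_law t k, hπ t k] with ω hω hωp
      rwa [hω]
    · filter_upwards [hmem, h.trajectory] with ω hω htr
      -- Restricting the sum to the times when `k` is drawn only drops nonnegative gaps of other
      -- lenders.
      refine (Finset.sum_le_sum fun t _ => ?_).trans ((htr.sum_gap_le h0 h1 T).trans
        (div_le_div_of_nonneg_right (sub_le_sub_right
          (hM (Set.mem_image_of_mem _ (hω T))) _) h0.le))
      by_cases hk : i t ω = k
      · simp [hk]
      · simpa [hk] using G.gap_nonneg (hω t (i t ω))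
  filter_upwards [hmem, ae_all_iff.2 hgap] with ω hω hg
  exact G.tendsto_of_gap_tendsto_zero hStar hω hg

end LendingGame

theorem theorem4p4 {m n : ℕ} (G : LendingGame m n) :
    ∃ sStar : Fin m → Fin n → ℝ,
      G.IsPureNash sStar ∧ (∀ s', G.IsPureNash s' → s' = sStar) ∧
      ∀ α : ℝ, 0 < α → α ≤ 1 → ∀ s₀ ∈ G.strategySpace,
        ∀ {Ω : Type*} [MeasurableSpace Ω] (μ : Measure Ω) [IsProbabilityMeasure μ]
          (ℱ : Filtration ℕ ‹MeasurableSpace Ω›) (π : ℕ → Ω → PMF (Fin m))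
          (i : ℕ → Ω → Fin m) (s : ℕ → Ω → Fin m → Fin n → ℝ),
          G.IsRandomisedBestResponseDynamics α s₀ μ ℱ π i s →
            ∀ᵐ ω ∂μ, Tendsto (fun t => s t ω) atTop (𝓝 sStar) := by
  obtain ⟨sStar, hStar⟩ := G.exists_isPureNash
  exact ⟨sStar, hStar, fun _ hs' => hStar.eq hs', fun _ h0 h1 _ hs₀ _ _ _ _ _ _ _ _ h =>
    h.ae_tendsto hStar h0 h1 hs₀⟩
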